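/- Two players $i\in\{1,2\}$ compete on a finite set $B$ of battlefields. Battlefield $k$ has value $v^k>0$ for both players, and player $i$ has constant marginal cost of effort $c_i>0$ and a spillover network $\rho_i=(\rho_i^{k,l})_{k,l\in B}$ with $\rho_i^{k,l}\ge 0$. Each player $i$ chooses a vector of efforts $e_i\in\mathbb{R}_{\ge 0}^B$, which yields the vector of effective efforts $y_i=(I+\rho_i^{T})e_i$. Player $i$ wins battlefield $k$ with probability $p_i^k(e_1,e_2)=p_i(y_1^k,y_2^k)$, where $p$ is the Tullock contest success function \[ p_i(y_1,y_2)=\frac{y_i^{\gamma}}{y_1^{\gamma}+y_2^{\gamma}}\quad\text{for }(y_1,y_2)\neq(0,0),\qquad \gamma\in(0,1], \] and $p_1(0,0),p_2(0,0)\ge 0$ are any fixed numbers with $p_1(0,0)+p_2(0,0)=1$. The payoff of player $i$ is \[ \Pi_i(e_1,e_2)=\sum_{k\in B}v^k p_i^k(e_1,e_2)-c_i\sum_{k\in B}e_i^k . \] Then this game has a pure-strategy Nash equilibrium. Moreover, for any two pure-strategy Nash equilibria and each player $i$, the payoffs of player $i$, the probabilities of player $i$ winning each battlefield $k\in B$,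 and the total efforts $\sum_{k\in B}e_i^k$ of player $i$ are the same in both equilibria. -/

import Mathlib

open scoped Matrix

/-- Primitives of a two-player interconnected contest on a finite set `B` of battlefields.
The two players are the elements of `Fin 2`. -/
structure InterconnectedContest (B : Type*) where
  /-- the value of each battlefield, common to both players -/
  value : B → ℝ
  /-- the constant marginal cost of effort of each player -/
  cost : Fin 2 → ℝ
  /-- the spillover networks: `spill i k l` is the rate at which effort of player `i`
  at battlefield `k` spills over to battlefield `l` -/
  spill : Fin 2 → Matrix B B ℝ
  /-- the exponent of the Tullock contest success function -/
  γ : ℝ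
  /-- the winning probabilities of the two players at a battlefield
  to which neither of them brings any effective effort -/
  tie : Fin 2 → ℝ

namespace InterconnectedContest

/-- The Tullock contest success function: the probability that player `i` wins a battlefield
at which the effective efforts of the two players are `y 0` and `y 1`. The Tullock ratio is
`0 / 0` if both efforts vanish, and the value is then the tie probability `τ i`. -/
noncomputable def tullock (γ : ℝ) (τ : Fin 2 → ℝ) (i : Fin 2) (y : Fin 2 → ℝ) : ℝ :=
  if y 0 = 0 ∧ y 1 = 0 then τ i else y i ^ γ / (y 0 ^ γ + y 1 ^ γ)

variable {B : Type*} [Fintype B] [DecidableEq B]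

/-- The vector `(I + ρᵢᵀ) eᵢ` of effective efforts of player `i` under the effort profile `e`. -/
def effectiveEffort (C : InterconnectedContest B) (e : Fin 2 → B → ℝ) (i : Fin 2) : B → ℝ :=
  (1 + (C.spill i)ᵀ) *ᵥ e i

/-- For a network without self-loops, the effective effort at `k` is the effort assigned to `k`
plus the spillovers from all the other battlefields. -/
theorem effectiveEffort_apply (C : InterconnectedContest B) (e : Fin 2 → B → ℝ) (i : Fin 2)
    (k : B) (hk : C.spill i k k = 0) :
    C.effectiveEffort e i k = e i k + ∑ l ∈ Finset.univ.erase k, C.spill i l k * e i l := by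
  have h : ∑ l, C.spill i l k * e i l = ∑ l ∈ Finset.univ.erase k, C.spill i l k * e i l := by
    rw [← Finset.add_sum_erase _ _ (Finset.mem_univ k), hk, zero_mul, zero_add]
  rw [← h, effectiveEffort, Matrix.add_mulVec, Matrix.one_mulVec]
  rfl

/-- The probability that player `i` wins battlefield `k` under the effort profile `e`. -/
noncomputable def winProb (C : InterconnectedContest B) (e : Fin 2 → B → ℝ) (i : Fin 2)
    (k : B) : ℝ :=
  tullock C.γ C.tie i (fun j => C.effectiveEffort e j k)

/-- The expected payoff of player `i` under the effort profile `e`. -/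
noncomputable def payoff (C : InterconnectedContest B) (e : Fin 2 → B → ℝ) (i : Fin 2) : ℝ :=
  ∑ k, C.value k * C.winProb e i k - C.cost i * ∑ k, e i k

/-- Pure-strategy Nash equilibrium: all efforts are nonnegative and no player gains from a
unilateral deviation to another nonnegative vector of efforts. -/
def IsNashEquilibrium (C : InterconnectedContest B) (e : Fin 2 → B → ℝ) : Prop :=
  (∀ i k, 0 ≤ e i k) ∧
    ∀ (i : Fin 2) (x : B → ℝ), (∀ k, 0 ≤ x k) →
      C.payoff (Function.update e i x) i ≤ C.payoff e i

end InterconnectedContest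

/-! Winning probabilities sum to one, so the two payoffs sum to the total value minus both effort
costs (`payoff_add`). Adding the rival's cost to one player's payoff leaves that player's incentives
unchanged and makes the game constant-sum up to own-effort terms. Equilibria are therefore
interchangeable (`payoff_interchange`).

Own payoff is concave, and averaging two efforts that give different winning probabilities yields a
strict gain (`tullockRatio_concave`). Interchangeable best replies thus share winning probabilities
(`winProb_eq_of_payoff_eq`), hence costs and payoffs.

For existence the only obstacle is the discontinuity at zero effective efforts. With efforts
confined to `[ε, M]`, Sion's theorem gives an equilibrium (`exists_equilibrium_restricted`). A limit
as `ε → 0` has no battlefield with both effective efforts zero, since a small extra effort there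
would almost secure the prize for either player. Payoffs are thus continuous at the limit, which is
an equilibrium. -/

open Filter Topology

namespace InterconnectedContest

/-- The Tullock winning probability of a contestant with effort `a` against a rival with
effort `r`, with value `t` if both efforts vanish. -/
noncomputable def tullockRatio (γ t a r : ℝ) : ℝ :=
  if a = 0 ∧ r = 0 then t else a ^ γ / (a ^ γ + r ^ γ)

theorem tullock_eq_tullockRatio (γ : ℝ) (τ : Fin 2 → ℝ) (i : Fin 2) (y : Fin 2 → ℝ) :
    tullock γ τ i y = tullockRatio γ (τ i) (y i) (y i.rev) := by
  fin_cases i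
  · rfl
  · simp [tullock, tullockRatio, and_comm, add_comm, Fin.rev]

/-! ### Monotonicity, concavity and continuity of the Tullock ratio -/

section Ratio

variable {γ t a b r : ℝ}

theorem tullockRatio_of_ne (h : a ≠ 0 ∨ r ≠ 0) :
    tullockRatio γ t a r = a ^ γ / (a ^ γ + r ^ γ) := by
  rw [tullockRatio, if_neg (by tauto)]

theorem tullockRatio_zero_right (hγ : 0 < γ) (ha : 0 < a) : tullockRatio γ t a 0 = 1 := by
  rw [tullockRatio_of_ne (Or.inl ha.ne'), Real.zero_rpow hγ.ne', add_zero,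
    div_self (Real.rpow_pos_of_pos ha γ).ne']

theorem rpow_add_rpow_pos (ha : 0 ≤ a) (hr : 0 ≤ r) (h : a ≠ 0 ∨ r ≠ 0) :
    0 < a ^ γ + r ^ γ := by
  rcases h with h | h
  · have := Real.rpow_pos_of_pos (ha.lt_of_ne' h) γ
    have := Real.rpow_nonneg hr γ
    linarith
  · have := Real.rpow_pos_of_pos (hr.lt_of_ne' h) γ
    have := Real.rpow_nonneg ha γ
    linarith

theorem tullockRatio_nonneg (ht : 0 ≤ t) (ha : 0 ≤ a) (hr : 0 ≤ r) :
    0 ≤ tullockRatio γ t a r := by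
  rw [tullockRatio]
  split_ifs
  · exact ht
  · positivity

theorem tullockRatio_add (ha : 0 ≤ a) (hr : 0 ≤ r) :
    tullockRatio γ t a r + tullockRatio γ (1 - t) r a = 1 := by
  by_cases h : a = 0 ∧ r = 0
  · simp [tullockRatio, h]
  · have h' : a ≠ 0 ∨ r ≠ 0 := by tauto
    rw [tullockRatio_of_ne h', tullockRatio_of_ne h'.symm, add_comm (r ^ γ), ← add_div,
      div_self (rpow_add_rpow_pos ha hr h').ne']

theorem tullockRatio_le_one (ht : t ≤ 1) (ha : 0 ≤ a) (hr : 0 ≤ r) :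
    tullockRatio γ t a r ≤ 1 := by
  have h1 := tullockRatio_add (γ := γ) (t := t) ha hr
  have h2 := tullockRatio_nonneg (γ := γ) (sub_nonneg.2 ht) hr ha
  linarith

theorem div_add_le_div_add {x y s : ℝ} (hx : 0 ≤ x) (hxy : x ≤ y) (hs : 0 < s) :
    x / (x + s) ≤ y / (y + s) := by
  rw [div_le_div_iff₀ (by linarith) (by linarith)]
  nlinarith

theorem tullockRatio_mono (hγ : 0 < γ) (ht : t ≤ 1) (ha : 0 ≤ a) (hab : a ≤ b) (hr : 0 ≤ r) :
    tullockRatio γ t a r ≤ tullockRatio γ t b r := by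
  rcases hr.eq_or_lt with rfl | hr
  · rcases (ha.trans hab).eq_or_lt with hb | hb
    · rw [le_antisymm hab (hb ▸ ha)]
    · rw [tullockRatio_zero_right hγ hb]
      exact tullockRatio_le_one ht ha le_rfl
  · rw [tullockRatio_of_ne (Or.inr hr.ne'), tullockRatio_of_ne (Or.inr hr.ne')]
    exact div_add_le_div_add (Real.rpow_nonneg ha γ) (Real.rpow_le_rpow ha hab hγ.le)
      (Real.rpow_pos_of_pos hr γ)

/-- The exact Jensen gap of `x / (x + s)`: its sign gives concavity, its vanishing the equality
case. -/
theorem div_add_convexCombination {x y s p q : ℝ} (hx : 0 ≤ x) (hy : 0 ≤ y) (hs : 0 < s)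
    (hp : 0 ≤ p) (hq : 0 ≤ q) (hpq : p + q = 1) :
    (p * x + q * y) / (p * x + q * y + s) - (p * (x / (x + s)) + q * (y / (y + s))) =
      s * p * q * (x - y) ^ 2 / ((p * x + q * y + s) * (x + s) * (y + s)) := by
  have h1 : x + s ≠ 0 := by positivity
  have h2 : y + s ≠ 0 := by positivity
  have h3 : p * x + q * y + s ≠ 0 := by positivity
  obtain rfl : q = 1 - p := by linarith
  field_simp
  ring

/-- For `r > 0` the concave power is composed with the increasing concave map `x / (x + s)`. For `r
= 0` the ratio jumps from `t` at zero to `1`, which is concave because `t ≤ 1`. -/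
theorem tullockRatio_concave (hγ : 0 < γ) (hγ1 : γ ≤ 1) (ht : t ≤ 1) (ha : 0 ≤ a) (hb : 0 ≤ b)
    (hr : 0 ≤ r) {p q : ℝ} (hp : 0 < p) (hq : 0 < q) (hpq : p + q = 1) :
    p * tullockRatio γ t a r + q * tullockRatio γ t b r ≤ tullockRatio γ t (p * a + q * b) r ∧
      (p * tullockRatio γ t a r + q * tullockRatio γ t b r = tullockRatio γ t (p * a + q * b) r →
        tullockRatio γ t a r = tullockRatio γ t b r) := by
  rcases hr.eq_or_lt with rfl | hr
  · have hat := tullockRatio_le_one (γ := γ) ht ha le_rfl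
    have hbt := tullockRatio_le_one (γ := γ) ht hb le_rfl
    by_cases hab : a = 0 ∧ b = 0
    · obtain ⟨rfl, rfl⟩ := hab
      simp only [mul_zero, add_zero, implies_true, and_true]
      rw [← add_mul, hpq, one_mul]
    · have hpos : 0 < p * a + q * b := by
        rcases not_and_or.1 hab with h | h
        · have := ha.lt_of_ne' h
          positivity
        · have := hb.lt_of_ne' h
          positivity
      rw [tullockRatio_zero_right hγ hpos]
      refine ⟨by nlinarith, fun h => ?_⟩
      have ha1 : tullockRatio γ t a 0 = 1 := by nlinarith
      have hb1 : tullockRatio γ t b 0 = 1 := by nlinarith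
      rw [ha1, hb1]
  · have hA := Real.rpow_nonneg ha γ
    have hB := Real.rpow_nonneg hb γ
    have hs := Real.rpow_pos_of_pos hr γ
    have hcomb := div_add_convexCombination hA hB hs hp.le hq.le hpq
    have hM : p * a ^ γ + q * b ^ γ ≤ (p * a + q * b) ^ γ := by
      simpa using (Real.concaveOn_rpow hγ.le hγ1).2 ha hb hp.le hq.le hpq
    have hmono := div_add_le_div_add (by positivity) hM hs
    simp only [tullockRatio_of_ne (Or.inr hr.ne')]
    have hnn : 0 ≤ r ^ γ * p * q * (a ^ γ - b ^ γ) ^ 2 /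
        ((p * a ^ γ + q * b ^ γ + r ^ γ) * (a ^ γ + r ^ γ) * (b ^ γ + r ^ γ)) := by positivity
    refine ⟨by linarith, fun h => ?_⟩
    by_contra hne
    have hAB : a ^ γ - b ^ γ ≠ 0 := fun h0 => hne (by rw [sub_eq_zero.1 h0])
    have : 0 < r ^ γ * p * q * (a ^ γ - b ^ γ) ^ 2 /
        ((p * a ^ γ + q * b ^ γ + r ^ γ) * (a ^ γ + r ^ γ) * (b ^ γ + r ^ γ)) := by positivity
    linarith

theorem tendsto_tullockRatio {ι : Type*} {l : Filter ι} {f g : ι → ℝ} (hγ : 0 < γ)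
    (ha : 0 ≤ a) (hr : 0 ≤ r) (h : a ≠ 0 ∨ r ≠ 0) (hf : Tendsto f l (𝓝 a))
    (hg : Tendsto g l (𝓝 r)) :
    Tendsto (fun n => tullockRatio γ t (f n) (g n)) l (𝓝 (tullockRatio γ t a r)) := by
  have hev : ∀ᶠ n in l, f n ≠ 0 ∨ g n ≠ 0 := by
    rcases h with h | h
    · exact (hf.eventually_ne h).mono fun _ => Or.inl
    · exact (hg.eventually_ne h).mono fun _ => Or.inr
  have hfp := hf.rpow_const (p := γ) (Or.inr hγ.le)
  have hgp := hg.rpow_const (p := γ) (Or.inr hγ.le)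
  rw [tullockRatio_of_ne h]
  refine (hfp.div (hfp.add hgp) (rpow_add_rpow_pos ha hr h).ne').congr' ?_
  filter_upwards [hev] with n hn
  exact (tullockRatio_of_ne hn).symm

end Ratio

section Primitives

variable {B : Type*} (C : InterconnectedContest B)

/-- The assumptions on the primitives of the contest. -/
structure Regular : Prop where
  value_pos : ∀ k, 0 < C.value k
  cost_pos : ∀ i, 0 < C.cost i
  spill_nonneg : ∀ i k l, 0 ≤ C.spill i k l
  γ_pos : 0 < C.γ
  γ_le : C.γ ≤ 1
  tie_nonneg : ∀ i, 0 ≤ C.tie i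
  tie_sum : C.tie 0 + C.tie 1 = 1

theorem rev_ne (i : Fin 2) : i.rev ≠ i := by
  fin_cases i <;> simp [Fin.rev]

variable {C}

namespace Regular

theorem tie_le_one (hC : C.Regular) (i : Fin 2) : C.tie i ≤ 1 := by
  have h0 := hC.tie_nonneg 0
  have h1 := hC.tie_nonneg 1
  have := hC.tie_sum
  fin_cases i <;> simp <;> linarith

theorem tie_rev (hC : C.Regular) (i : Fin 2) : C.tie i.rev = 1 - C.tie i := by
  have := hC.tie_sum
  fin_cases i <;> simp [Fin.rev] <;> linarith

theorem update_nonneg {e : Fin 2 → B → ℝ} (he : ∀ i k, 0 ≤ e i k) (i : Fin 2) {x : B → ℝ}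
    (hx : ∀ k, 0 ≤ x k) : ∀ j k, 0 ≤ Function.update e i x j k := by
  intro j k
  rcases eq_or_ne j i with rfl | h
  · simpa using hx k
  · simpa [h] using he j k

theorem update_eq_update_rev (e e' : Fin 2 → B → ℝ) (i : Fin 2) :
    Function.update e i (e' i) = Function.update e' i.rev (e i.rev) := by
  funext j
  fin_cases i <;> fin_cases j <;> simp [Fin.rev, Function.update]

end Regular

end Primitives

/-! ### Payoffs as functions of own effort -/

section Contest

variable {B : Type*} [Fintype B] [DecidableEq B] (C : InterconnectedContest B)

/-- The effective efforts that player `i` obtains from the vector of efforts `x`. -/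
def transfer (i : Fin 2) (x : B → ℝ) : B → ℝ := (1 + (C.spill i)ᵀ) *ᵥ x

theorem transfer_apply (i : Fin 2) (x : B → ℝ) (k : B) :
    C.transfer i x k = x k + ∑ l, C.spill i l k * x l := by
  rw [transfer, Matrix.add_mulVec, Matrix.one_mulVec]
  rfl

theorem winProb_eq (e : Fin 2 → B → ℝ) (i : Fin 2) (k : B) :
    C.winProb e i k =
      tullockRatio C.γ (C.tie i) (C.transfer i (e i) k) (C.transfer i.rev (e i.rev) k) :=
  tullock_eq_tullockRatio _ _ _ _

theorem transfer_combination (i : Fin 2) (x z : B → ℝ) (p q : ℝ) (k : B) :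
    C.transfer i (p • x + q • z) k = p * C.transfer i x k + q * C.transfer i z k := by
  simp [transfer, Matrix.mulVec_add, Matrix.mulVec_smul]

theorem continuous_transfer (i : Fin 2) (k : B) : Continuous fun x => C.transfer i x k := by
  simp only [transfer_apply]
  fun_prop

variable {C}

namespace Regular

theorem le_transfer (hC : C.Regular) {i : Fin 2} {x : B → ℝ} (hx : ∀ k, 0 ≤ x k) (k : B) :
    x k ≤ C.transfer i x k := by
  rw [transfer_apply]
  have : 0 ≤ ∑ l, C.spill i l k * x l :=
    Finset.sum_nonneg fun l _ => mul_nonneg (hC.spill_nonneg i l k) (hx l)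
  linarith

theorem transfer_nonneg (hC : C.Regular) {i : Fin 2} {x : B → ℝ} (hx : ∀ k, 0 ≤ x k) (k : B) :
    0 ≤ C.transfer i x k :=
  (hx k).trans (hC.le_transfer hx k)

theorem transfer_mono (hC : C.Regular) {i : Fin 2} {x z : B → ℝ} (h : ∀ k, x k ≤ z k) (k : B) :
    C.transfer i x k ≤ C.transfer i z k := by
  rw [transfer_apply, transfer_apply]
  exact add_le_add (h k) (Finset.sum_le_sum fun l _ =>
    mul_le_mul_of_nonneg_left (h l) (hC.spill_nonneg i l k))

theorem winProb_nonneg (hC : C.Regular) {e : Fin 2 → B → ℝ} (he : ∀ i k, 0 ≤ e i k)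
    (i : Fin 2) (k : B) : 0 ≤ C.winProb e i k := by
  rw [winProb_eq]
  exact tullockRatio_nonneg (hC.tie_nonneg i) (hC.transfer_nonneg (he _) k)
    (hC.transfer_nonneg (he _) k)

theorem winProb_add (hC : C.Regular) {e : Fin 2 → B → ℝ} (he : ∀ i k, 0 ≤ e i k)
    (i : Fin 2) (k : B) : C.winProb e i k + C.winProb e i.rev k = 1 := by
  rw [winProb_eq, winProb_eq, Fin.rev_rev, hC.tie_rev]
  exact tullockRatio_add (hC.transfer_nonneg (he _) k) (hC.transfer_nonneg (he _) k)

theorem winProb_le_one (hC : C.Regular) {e : Fin 2 → B → ℝ} (he : ∀ i k, 0 ≤ e i k)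
    (i : Fin 2) (k : B) : C.winProb e i k ≤ 1 := by
  have h1 := hC.winProb_add he i k
  have h2 := hC.winProb_nonneg he i.rev k
  linarith

theorem payoff_add (hC : C.Regular) {e : Fin 2 → B → ℝ} (he : ∀ i k, 0 ≤ e i k) (i : Fin 2) :
    C.payoff e i + C.payoff e i.rev =
      ∑ k, C.value k - C.cost i * ∑ k, e i k - C.cost i.rev * ∑ k, e i.rev k := by
  have : ∑ k, C.value k = ∑ k, C.value k * C.winProb e i k +
      ∑ k, C.value k * C.winProb e i.rev k := by
    rw [← Finset.sum_add_distrib]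
    refine Finset.sum_congr rfl fun k _ => ?_
    rw [← mul_add, hC.winProb_add he, mul_one]
  rw [payoff, payoff, this]
  ring

theorem winProb_update (e : Fin 2 → B → ℝ) (i : Fin 2) (x : B → ℝ) (k : B) :
    C.winProb (Function.update e i x) i k =
      tullockRatio C.γ (C.tie i) (C.transfer i x k) (C.transfer i.rev (e i.rev) k) := by
  rw [winProb_eq, Function.update_self, Function.update_of_ne (rev_ne i)]

theorem payoff_update (e : Fin 2 → B → ℝ) (i : Fin 2) (x : B → ℝ) :
    C.payoff (Function.update e i x) i =
      ∑ k, C.value k * C.winProb (Function.update e i x) i k - C.cost i * ∑ k, x k := by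
  rw [payoff, Function.update_self]

theorem winProb_update_mono (hC : C.Regular) {e : Fin 2 → B → ℝ} (he : ∀ i k, 0 ≤ e i k)
    (i : Fin 2) {x z : B → ℝ} (hx : ∀ k, 0 ≤ x k) (hxz : ∀ k, x k ≤ z k) (k : B) :
    C.winProb (Function.update e i x) i k ≤ C.winProb (Function.update e i z) i k := by
  rw [winProb_update, winProb_update]
  exact tullockRatio_mono hC.γ_pos (hC.tie_le_one i) (hC.transfer_nonneg hx k)
    (hC.transfer_mono hxz k) (hC.transfer_nonneg (he _) k)

theorem winProb_update_concave (hC : C.Regular) {e : Fin 2 → B → ℝ} (he : ∀ i k, 0 ≤ e i k)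
    (i : Fin 2) {x z : B → ℝ} (hx : ∀ k, 0 ≤ x k) (hz : ∀ k, 0 ≤ z k) {p q : ℝ} (hp : 0 < p)
    (hq : 0 < q) (hpq : p + q = 1) (k : B) :
    p * C.winProb (Function.update e i x) i k + q * C.winProb (Function.update e i z) i k ≤
        C.winProb (Function.update e i (p • x + q • z)) i k ∧
      (p * C.winProb (Function.update e i x) i k + q * C.winProb (Function.update e i z) i k =
        C.winProb (Function.update e i (p • x + q • z)) i k →
        C.winProb (Function.update e i x) i k = C.winProb (Function.update e i z) i k) := by
  simp only [winProb_update, transfer_combination]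
  exact tullockRatio_concave hC.γ_pos hC.γ_le (hC.tie_le_one i) (hC.transfer_nonneg hx k)
    (hC.transfer_nonneg hz k) (hC.transfer_nonneg (he _) k) hp hq hpq

/-- Costs are linear and cancel, leaving only the Jensen gaps of the winning probabilities. -/
theorem payoff_update_combination_sub (e : Fin 2 → B → ℝ) (i : Fin 2) (x z : B → ℝ) (p q : ℝ) :
    C.payoff (Function.update e i (p • x + q • z)) i -
        (p * C.payoff (Function.update e i x) i + q * C.payoff (Function.update e i z) i) =
      ∑ k, C.value k * (C.winProb (Function.update e i (p • x + q • z)) i k -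
        (p * C.winProb (Function.update e i x) i k +
          q * C.winProb (Function.update e i z) i k)) := by
  simp only [payoff_update, mul_sub, mul_add, Finset.sum_sub_distrib, Finset.sum_add_distrib,
    Pi.add_apply, Pi.smul_apply, smul_eq_mul, Finset.mul_sum]
  simp only [mul_left_comm p, mul_left_comm q]
  ring

theorem payoff_update_concave (hC : C.Regular) {e : Fin 2 → B → ℝ} (he : ∀ i k, 0 ≤ e i k)
    (i : Fin 2) {S : Set (B → ℝ)} (hS : Convex ℝ S) (hS0 : ∀ x ∈ S, ∀ k, 0 ≤ x k) :
    ConcaveOn ℝ S fun x => C.payoff (Function.update e i x) i := by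
  rw [concaveOn_iff_forall_pos]
  refine ⟨hS, fun x hx z hz p q hp hq hpq => ?_⟩
  rw [← sub_nonneg, smul_eq_mul, smul_eq_mul, payoff_update_combination_sub]
  exact Finset.sum_nonneg fun k _ => mul_nonneg (hC.value_pos k).le
    (sub_nonneg.2 (hC.winProb_update_concave he i (hS0 x hx) (hS0 z hz) hp hq hpq k).1)

/-! ### Uniqueness of equilibrium outcomes -/

/-- The midpoint of two best replies cannot do better than either, so every nonnegative Jensen gap
vanishes. -/
theorem winProb_eq_of_payoff_eq (hC : C.Regular) {e : Fin 2 → B → ℝ}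
    (he : C.IsNashEquilibrium e) (i : Fin 2) {x : B → ℝ} (hx : ∀ k, 0 ≤ x k)
    (h : C.payoff (Function.update e i x) i = C.payoff e i) (k : B) :
    C.winProb (Function.update e i x) i k = C.winProb e i k := by
  have hhalf : (0 : ℝ) < 1 / 2 := by norm_num
  have hsum : (1 / 2 : ℝ) + 1 / 2 = 1 := by norm_num
  have hdev := he.2 i ((1 / 2 : ℝ) • x + (1 / 2 : ℝ) • e i) fun k => by
    have := hx k
    have := he.1 i k
    simp only [Pi.add_apply, Pi.smul_apply, smul_eq_mul]
    positivity
  have hsub := payoff_update_combination_sub (C := C) e i x (e i) (1 / 2) (1 / 2)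
  have hconc := hC.winProb_update_concave he.1 i hx (he.1 i) hhalf hhalf hsum
  rw [Function.update_eq_self] at hsub hconc
  have hterm : ∀ k ∈ Finset.univ, 0 ≤ C.value k *
      (C.winProb (Function.update e i ((1 / 2 : ℝ) • x + (1 / 2 : ℝ) • e i)) i k -
        (1 / 2 * C.winProb (Function.update e i x) i k + 1 / 2 * C.winProb e i k)) :=
    fun k _ => mul_nonneg (hC.value_pos k).le (sub_nonneg.2 (hconc k).1)
  have hzero := (Finset.sum_eq_zero_iff_of_nonneg hterm).1
    (le_antisymm (by rw [← hsub]; linarith) (Finset.sum_nonneg hterm)) k (Finset.mem_univ k)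
  refine (hconc k).2 ?_
  rcases mul_eq_zero.1 hzero with h0 | h0
  · exact absurd h0 (hC.value_pos k).ne'
  · linarith

/-- The payoff sum separates over players, so its total over the two equilibria equals that over the
two mixed profiles. The four deviation inequalities add up to an equality, so each is tight. -/
theorem payoff_interchange (hC : C.Regular) {e e' : Fin 2 → B → ℝ}
    (he : C.IsNashEquilibrium e) (he' : C.IsNashEquilibrium e') (i : Fin 2) :
    C.payoff (Function.update e i (e' i)) i = C.payoff e i := by
  have h1 := he.2 i (e' i) (he'.1 i)
  have h2 := he.2 i.rev (e' i.rev) (he'.1 _)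
  have h3 := he'.2 i (e i) (he.1 i)
  have h4 := he'.2 i.rev (e i.rev) (he.1 _)
  rw [← update_eq_update_rev e e' i] at h4
  rw [← update_eq_update_rev e' e i] at h2
  have s1 := hC.payoff_add he.1 i
  have s2 := hC.payoff_add he'.1 i
  have s3 := hC.payoff_add (update_nonneg he.1 i (he'.1 i)) i
  have s4 := hC.payoff_add (update_nonneg he'.1 i (he.1 i)) i
  simp only [Function.update_self, Function.update_of_ne (rev_ne i)] at s3 s4
  linarith

/-- The mixed profile is a deviation by `i` from `e` and by the rival from `e'`; its winning
probabilities agree with both. -/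
theorem winProb_unique (hC : C.Regular) {e e' : Fin 2 → B → ℝ}
    (he : C.IsNashEquilibrium e) (he' : C.IsNashEquilibrium e') (i : Fin 2) (k : B) :
    C.winProb e i k = C.winProb e' i k := by
  have h1 := hC.winProb_eq_of_payoff_eq he i (he'.1 i) (hC.payoff_interchange he he' i) k
  have h2 := hC.winProb_eq_of_payoff_eq he' i.rev (he.1 i.rev)
    (hC.payoff_interchange he' he i.rev) k
  rw [← update_eq_update_rev e e' i] at h2
  have s1 := hC.winProb_add (update_nonneg he.1 i (he'.1 i)) i k
  have s2 := hC.winProb_add he'.1 i k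
  linarith

theorem sum_effort_unique (hC : C.Regular) {e e' : Fin 2 → B → ℝ}
    (he : C.IsNashEquilibrium e) (he' : C.IsNashEquilibrium e') (i : Fin 2) :
    ∑ k, e i k = ∑ k, e' i k := by
  have h := hC.payoff_interchange he he' i
  have hw := hC.winProb_eq_of_payoff_eq he i (he'.1 i) h
  rw [payoff_update, payoff, Finset.sum_congr rfl fun k _ => by rw [hw k]] at h
  exact (mul_left_cancel₀ (hC.cost_pos i).ne' (by linarith)).symm

theorem payoff_unique (hC : C.Regular) {e e' : Fin 2 → B → ℝ}
    (he : C.IsNashEquilibrium e) (he' : C.IsNashEquilibrium e') (i : Fin 2) :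
    C.payoff e i = C.payoff e' i := by
  simp only [payoff, hC.winProb_unique he he', hC.sum_effort_unique he he']

/-! ### Existence of an equilibrium -/

theorem tendsto_payoff (hC : C.Regular) {ι : Type*} {l : Filter ι} {f : ι → Fin 2 → B → ℝ}
    {e : Fin 2 → B → ℝ} (he : ∀ i k, 0 ≤ e i k) (i : Fin 2)
    (h : ∀ k, C.transfer i (e i) k ≠ 0 ∨ C.transfer i.rev (e i.rev) k ≠ 0)
    (hf : Tendsto f l (𝓝 e)) : Tendsto (fun n => C.payoff (f n) i) l (𝓝 (C.payoff e i)) := by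
  have hcoord := fun j => tendsto_pi_nhds.1 hf j
  unfold payoff
  refine Tendsto.sub (tendsto_finsetSum _ fun k _ => Tendsto.const_mul _ ?_)
    (Tendsto.const_mul _ (tendsto_finsetSum _ fun k _ => tendsto_pi_nhds.1 (hcoord i) k))
  simp only [winProb_eq]
  exact tendsto_tullockRatio hC.γ_pos (hC.transfer_nonneg (he _) k) (hC.transfer_nonneg (he _) k)
    (h k) (((C.continuous_transfer i k).tendsto _).comp (hcoord i))
    (((C.continuous_transfer i.rev k).tendsto _).comp (hcoord i.rev))

theorem continuousOn_payoff_update (hC : C.Regular) {e : Fin 2 → B → ℝ} (he : ∀ i k, 0 ≤ e i k)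
    (i j : Fin 2) {S : Set (B → ℝ)} (hS : ∀ x ∈ S, ∀ k, 0 < x k) :
    ContinuousOn (fun x => C.payoff (Function.update e j x) i) S := by
  intro x hx
  have hx0 : ∀ k, 0 ≤ x k := fun k => (hS x hx k).le
  refine hC.tendsto_payoff (update_nonneg he j hx0) i (fun k => ?_) ?_
  · have hpos : C.transfer j x k ≠ 0 := ((hS x hx k).trans_le (hC.le_transfer hx0 k)).ne'
    rcases eq_or_ne i j with rfl | hij
    · left
      simpa using hpos
    · obtain rfl : j = i.rev := by
        fin_cases i <;> fin_cases j <;> simp_all [Fin.rev]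
      right
      simpa using hpos
  · have hcont : Continuous fun z : B → ℝ => Function.update e j z :=
      continuous_const.update j continuous_id
    exact (hcont.tendsto x).mono_left nhdsWithin_le_nhds

/-- The contest in which the efforts are restricted to an interval `[ε, M]` of positive numbers
has a pure-strategy Nash equilibrium. -/
theorem exists_equilibrium_restricted (hC : C.Regular) {ε M : ℝ} (hε : 0 < ε) (hM : ε ≤ M) :
    ∃ e : Fin 2 → B → ℝ, (∀ i k, ε ≤ e i k ∧ e i k ≤ M) ∧
      ∀ (i : Fin 2) (x : B → ℝ), (∀ k, ε ≤ x k ∧ x k ≤ M) →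
        C.payoff (Function.update e i x) i ≤ C.payoff e i := by
  set S : Set (B → ℝ) := Set.Icc (fun _ => ε) (fun _ => M) with hSdef
  have hmem : ∀ x : B → ℝ, x ∈ S ↔ ∀ k, ε ≤ x k ∧ x k ≤ M := fun x => by
    simp [hSdef, Set.mem_Icc, Pi.le_def, forall_and]
  have hSpos : ∀ x ∈ S, ∀ k, 0 < x k := fun x hx k => hε.trans_le ((hmem x).1 hx k).1
  have hS0 : ∀ x ∈ S, ∀ k, 0 ≤ x k := fun x hx k => (hSpos x hx k).le
  have hSne : S.Nonempty := ⟨fun _ => ε, (hmem _).2 fun _ => ⟨le_rfl, hM⟩⟩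
  have hSc : Convex ℝ S := convex_Icc _ _
  have hSk : IsCompact S := isCompact_Icc
  have hnn : ∀ x ∈ S, ∀ y ∈ S, ∀ i k, 0 ≤ (![y, x] : Fin 2 → B → ℝ) i k := by
    intro x hx y hy i k
    fin_cases i
    · exact hS0 y hy k
    · exact hS0 x hx k
  have hup0 : ∀ x y z : B → ℝ, Function.update ![y, x] 0 z = ![z, x] := fun x y z => by
    funext i
    fin_cases i <;> simp
  have hup1 : ∀ x y z : B → ℝ, Function.update ![y, x] 1 z = ![y, z] := fun x y z => by
    funext i
    fin_cases i <;> simp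
  -- Here `x` belongs to player `1`, who minimizes, and `y` to player `0`, who maximizes; the added
  -- cost term does not depend on `y`.
  let f : (B → ℝ) → (B → ℝ) → ℝ := fun x y => C.payoff ![y, x] 0 + C.cost 1 * ∑ k, x k
  have hf1 : ∀ x ∈ S, ∀ y ∈ S,
      f x y = ∑ k, C.value k - C.cost 0 * ∑ k, y k - C.payoff ![y, x] 1 := by
    intro x hx y hy
    have := hC.payoff_add (hnn x hx y hy) 0
    simp only [Fin.rev_zero, Fin.last, Nat.reduceAdd, Fin.reduceFinMk, Matrix.cons_val_zero,
      Matrix.cons_val_one] at this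
    simp only [f]
    linarith
  obtain ⟨a, ha, b, hb, hab⟩ := Sion.exists_isSaddlePointOn (f := f) hSne hSc hSk
    (fun y hy => by
      refine ContinuousOn.lowerSemicontinuousOn (ContinuousOn.add ?_ (by fun_prop))
      simpa only [hup1] using hC.continuousOn_payoff_update (hnn y hy y hy) 0 1 hSpos)
    (fun y hy => by
      have h := (hC.payoff_update_concave (hnn y hy y hy) 1 hSc hS0).neg.add_const
        (∑ k, C.value k - C.cost 0 * ∑ k, y k)
      refine (h.congr fun x hx => ?_).quasiconvexOn
      simp only [hup1, Pi.add_apply, Pi.neg_apply, hf1 x hx y hy]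
      ring)
    hSc hSne hSk
    (fun x hx => by
      refine ContinuousOn.upperSemicontinuousOn (ContinuousOn.add ?_ (by fun_prop))
      simpa only [hup0] using hC.continuousOn_payoff_update (hnn x hx x hx) 0 0 hSpos)
    (fun x hx => by
      have h := (hC.payoff_update_concave (hnn x hx x hx) 0 hSc hS0).add_const
        (C.cost 1 * ∑ k, x k)
      refine (h.congr fun y hy => ?_).quasiconcaveOn
      simp only [hup0, f, Pi.add_apply])
  refine ⟨![b, a], fun i => ?_, fun i x hx => ?_⟩
  · fin_cases i
    · exact (hmem b).1 hb
    · exact (hmem a).1 ha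
  · rw [← hmem] at hx
    fin_cases i
    · have := hab a ha x hx
      simp only [f] at this
      simp only [Fin.zero_eta, hup0]
      linarith
    · have := hab x hx b hb
      rw [hf1 a ha b hb, hf1 x hx b hb] at this
      simp only [Fin.mk_one, hup1]
      linarith

/-- Spillovers never hurt their owner, so the gain at `k` alone cannot exceed the cost of the extra
`δ`. -/
theorem winProb_update_add_single_le (hC : C.Regular) {e : Fin 2 → B → ℝ}
    (he : ∀ i k, 0 ≤ e i k) (i : Fin 2) (k : B) {δ : ℝ} (hδ : 0 ≤ δ)
    (h : C.payoff (Function.update e i (e i + Pi.single k δ)) i ≤ C.payoff e i) :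
    C.value k * tullockRatio C.γ (C.tie i) δ (C.transfer i.rev (e i.rev) k) ≤
      C.value k * C.winProb e i k + C.cost i * δ := by
  obtain ⟨z, hz⟩ : ∃ z : B → ℝ, z = e i + Pi.single k δ := ⟨_, rfl⟩
  rw [← hz] at h
  have hle : ∀ l, e i l ≤ z l := fun l => by
    have : (0 : B → ℝ) ≤ Pi.single k δ := Pi.single_nonneg.2 hδ
    simpa [hz] using this l
  have hsum : ∑ l, z l = ∑ l, e i l + δ := by
    simp [hz, Finset.sum_add_distrib]
  have hmono := hC.winProb_update_mono he i (he i) hle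
  rw [Function.update_eq_self] at hmono
  have hdiff : C.value k * (C.winProb (Function.update e i z) i k - C.winProb e i k) ≤
      C.cost i * δ := by
    have hnn : ∀ l ∈ Finset.univ,
        0 ≤ C.value l * (C.winProb (Function.update e i z) i l - C.winProb e i l) :=
      fun l _ => mul_nonneg (hC.value_pos l).le (sub_nonneg.2 (hmono l))
    have h1 := Finset.single_le_sum hnn (Finset.mem_univ k)
    rw [payoff_update, payoff, hsum] at h
    simp only [mul_sub, Finset.sum_sub_distrib] at h1 ⊢
    linarith
  have hδk : δ ≤ C.transfer i z k := by
    refine le_trans ?_ (hC.le_transfer (fun l => (he i l).trans (hle l)) k)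
    simpa [hz] using he i k
  have hratio := tullockRatio_mono hC.γ_pos (hC.tie_le_one i) hδ hδk
    (hC.transfer_nonneg (i := i.rev) (he i.rev) k)
  rw [← winProb_update] at hratio
  have := mul_le_mul_of_nonneg_left hratio (hC.value_pos k).le
  linarith

/-- Shifting a deviation by `η` makes it admissible in the restricted contests and avoids the
discontinuity, at a cost that vanishes with `η`. -/
theorem payoff_update_le_add_const (hC : C.Regular) {e : Fin 2 → B → ℝ}
    (he : ∀ i k, 0 ≤ e i k) (i : Fin 2) {x : B → ℝ} (hx : ∀ k, 0 ≤ x k) {η : ℝ} (hη : 0 ≤ η) :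
    C.payoff (Function.update e i x) i ≤
      C.payoff (Function.update e i fun k => x k + η) i + C.cost i * Fintype.card B * η := by
  have h := Finset.sum_le_sum fun k (_ : k ∈ Finset.univ) => mul_le_mul_of_nonneg_left
    (hC.winProb_update_mono he i (z := fun k => x k + η) hx (fun k => by linarith) k)
    (hC.value_pos k).le
  rw [payoff_update, payoff_update, Finset.sum_add_distrib, Finset.sum_const, Finset.card_univ,
    nsmul_eq_mul]
  linarith

theorem payoff_update_zero_nonneg (hC : C.Regular) {e : Fin 2 → B → ℝ}
    (he : ∀ i k, 0 ≤ e i k) (i : Fin 2) : 0 ≤ C.payoff (Function.update e i 0) i := by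
  rw [payoff_update]
  simp only [Pi.zero_apply, Finset.sum_const_zero, mul_zero, sub_zero]
  exact Finset.sum_nonneg fun k _ => mul_nonneg (hC.value_pos k).le
    (hC.winProb_nonneg (update_nonneg he i fun _ => le_rfl) i k)

theorem payoff_update_neg (hC : C.Regular) {e : Fin 2 → B → ℝ}
    (he : ∀ i k, 0 ≤ e i k) (i : Fin 2) {x : B → ℝ} (hx : ∀ k, 0 ≤ x k) {k : B}
    (hk : (∑ l, C.value l) / C.cost i < x k) : C.payoff (Function.update e i x) i < 0 := by
  rw [div_lt_iff₀' (hC.cost_pos i)] at hk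
  have h1 : ∑ l, C.value l * C.winProb (Function.update e i x) i l ≤ ∑ l, C.value l :=
    Finset.sum_le_sum fun l _ => mul_le_of_le_one_right (hC.value_pos l).le
      (hC.winProb_le_one (update_nonneg he i hx) i l)
  have h2 := mul_le_mul_of_nonneg_left
    (Finset.single_le_sum (fun l _ => hx l) (Finset.mem_univ k)) (hC.cost_pos i).le
  rw [payoff_update]
  linarith

theorem exists_equilibrium (hC : C.Regular) : ∃ e, C.IsNashEquilibrium e := by
  set V : ℝ := ∑ k, C.value k with hV
  have hV0 : 0 ≤ V := Finset.sum_nonneg fun k _ => (hC.value_pos k).le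
  have hVc : ∀ i, 0 ≤ V / C.cost i := fun i => div_nonneg hV0 (hC.cost_pos i).le
  -- No effort above `V / C.cost i` is worthwhile; the extra `1` leaves room for the upward shifts
  -- below.
  set M : ℝ := V / C.cost 0 + V / C.cost 1 + 1 with hMdef
  have hM1 : 1 ≤ M := by linarith [hVc 0, hVc 1]
  have hMi : ∀ i, V / C.cost i + 1 ≤ M := fun i => by
    have h0 := hVc 0
    have h1 := hVc 1
    fin_cases i <;> simp only [Fin.zero_eta, Fin.mk_one] <;> linarith
  have hεpos : ∀ n : ℕ, (0 : ℝ) < 1 / ((n : ℝ) + 1) := fun n => Nat.one_div_pos_of_nat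
  have hε1 : ∀ n : ℕ, 1 / ((n : ℝ) + 1) ≤ 1 := fun n => by
    rw [div_le_one (by positivity)]
    linarith [Nat.cast_nonneg (α := ℝ) n]
  choose u hu hdev using fun n : ℕ =>
    hC.exists_equilibrium_restricted (hεpos n) ((hε1 n).trans hM1)
  have hu0 : ∀ n i k, 0 ≤ u n i k := fun n i k => (hεpos n).le.trans (hu n i k).1
  obtain ⟨e, heI, φ, hφ, hlim⟩ := (isCompact_Icc (a := (0 : Fin 2 → B → ℝ))
    (b := fun _ _ => M)).tendsto_subseq (x := u)
    fun n => ⟨fun i k => hu0 n i k, fun i k => (hu n i k).2⟩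
  have he : ∀ i k, 0 ≤ e i k := heI.1
  have hcoord : ∀ i k, Tendsto (fun n => u (φ n) i k) atTop (𝓝 (e i k)) := fun i k =>
    tendsto_pi_nhds.1 (tendsto_pi_nhds.1 hlim i) k
  have hεlim : Tendsto (fun n => 1 / ((φ n : ℝ) + 1)) atTop (𝓝 0) :=
    tendsto_one_div_add_atTop_nhds_zero_nat.comp hφ.tendsto_atTop
  have hT : ∀ i k, Tendsto (fun n => C.transfer i (u (φ n) i) k) atTop
      (𝓝 (C.transfer i (e i) k)) := fun i k =>
    ((C.continuous_transfer i k).tendsto _).comp (tendsto_pi_nhds.1 hlim i)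
  have hnotie : ∀ i k, C.transfer i (e i) k ≠ 0 ∨ C.transfer i.rev (e i.rev) k ≠ 0 := by
    intro i k
    by_contra hcon
    push Not at hcon
    have hzero : ∀ j, C.transfer j (e j) k = 0 := fun j => by
      rcases eq_or_ne j i with rfl | hj
      · exact hcon.1
      · obtain rfl : j = i.rev := by
          fin_cases i <;> fin_cases j <;> simp_all [Fin.rev]
        exact hcon.2
    have hek : ∀ j, e j k = 0 := fun j =>
      le_antisymm ((hC.le_transfer (he j) k).trans (hzero j).le) (he j k)
    have hv := hC.value_pos k
    have hc0 := hC.cost_pos i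
    have hc1 := hC.cost_pos i.rev
    -- The first bound keeps the deviation below `1 ≤ M`; the second keeps the players' combined
    -- cost of `δ` within half the prize.
    set δ : ℝ := min (1 / 2) (C.value k / (2 * (C.cost i + C.cost i.rev))) with hδdef
    have hδ : 0 < δ := lt_min (by norm_num) (by positivity)
    have hδhalf : δ ≤ 1 / 2 := min_le_left _ _
    have hδc : (C.cost i + C.cost i.rev) * δ ≤ C.value k / 2 := by
      calc (C.cost i + C.cost i.rev) * δ
          ≤ (C.cost i + C.cost i.rev) * (C.value k / (2 * (C.cost i + C.cost i.rev))) :=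
            mul_le_mul_of_nonneg_left (min_le_right _ _) (by positivity)
        _ = C.value k / 2 := by field_simp
    have hbound : ∀ j, ∀ᶠ n in atTop,
        C.value k * tullockRatio C.γ (C.tie j) δ (C.transfer j.rev (u (φ n) j.rev) k) ≤
          C.value k * C.winProb (u (φ n)) j k + C.cost j * δ := by
      intro j
      have hsmall : ∀ᶠ n in atTop, u (φ n) j k < 1 / 2 :=
        (hcoord j k).eventually_lt_const (by rw [hek]; norm_num)
      filter_upwards [hsmall] with n hn
      refine hC.winProb_update_add_single_le (hu0 _) j k hδ.le (hdev _ j _ fun l => ?_)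
      have hl := hu (φ n) j l
      rcases eq_or_ne l k with rfl | hlk
      · simp only [Pi.add_apply, Pi.single_eq_same]
        constructor <;> linarith
      · simpa [hlk] using hl
    have hratio : ∀ j, Tendsto (fun n => C.value k *
        tullockRatio C.γ (C.tie j) δ (C.transfer j.rev (u (φ n) j.rev) k)) atTop
        (𝓝 (C.value k)) := fun j => by
      have h := (tendsto_tullockRatio (t := C.tie j) hC.γ_pos hδ.le le_rfl (Or.inl hδ.ne')
        tendsto_const_nhds ((hT j.rev k).trans_eq (by rw [hzero]))).const_mul (C.value k)
      rwa [tullockRatio_zero_right hC.γ_pos hδ, mul_one] at h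
    -- Both deviations win with probability tending to one, while the actual probabilities sum to
    -- one: `2v ≤ v + v / 2`, which is absurd.
    have hle := le_of_tendsto ((hratio i).add (hratio i.rev))
      (b := C.value k + (C.cost i + C.cost i.rev) * δ) (by
        filter_upwards [hbound i, hbound i.rev] with n h1 h2
        have := hC.winProb_add (hu0 (φ n)) i k
        have : C.winProb (u (φ n)) i.rev k = 1 - C.winProb (u (φ n)) i k := by linarith
        rw [this] at h2
        linarith)
    linarith
  have hopt : ∀ (i : Fin 2) (x : B → ℝ), (∀ k, 0 ≤ x k) → (∀ k, x k ≤ V / C.cost i) →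
      C.payoff (Function.update e i x) i ≤ C.payoff e i := by
    intro i x hx hxV
    -- The limit in `n` is taken at fixed `η`, once the lower effort bound is below `η`; only then
    -- does `η` tend to zero.
    have hη : ∀ᶠ η in 𝓝[>] (0 : ℝ), C.payoff (Function.update e i x) i ≤
        C.payoff e i + C.cost i * Fintype.card B * η := by
      filter_upwards [Ioo_mem_nhdsGT (zero_lt_one (α := ℝ))] with η ⟨hη0, hη1⟩
      refine (hC.payoff_update_le_add_const he i hx hη0.le).trans (add_le_add_left ?_ _)
      have hz : ∀ k, 0 < x k + η := fun k => by linarith [hx k]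
      have hlim' : Tendsto (fun n => Function.update (u (φ n)) i fun k => x k + η) atTop
          (𝓝 (Function.update e i fun k => x k + η)) := hlim.update i tendsto_const_nhds
      refine le_of_tendsto_of_tendsto (hC.tendsto_payoff (update_nonneg he i fun k => (hz k).le)
        i (fun k => ?_) hlim') (hC.tendsto_payoff he i (hnotie i) hlim) ?_
      · left
        rw [Function.update_self]
        exact ((hz k).trans_le (hC.le_transfer (fun k => (hz k).le) k)).ne'
      · filter_upwards [hεlim.eventually_lt_const hη0] with n hn
        exact hdev _ i _ fun k => ⟨by linarith [hx k], by linarith [hxV k, hMi i]⟩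
    have hlim0 : Tendsto (fun η => C.payoff e i + C.cost i * Fintype.card B * η) (𝓝[>] (0 : ℝ))
        (𝓝 (C.payoff e i)) := by
      have : Continuous fun η : ℝ => C.payoff e i + C.cost i * Fintype.card B * η := by fun_prop
      simpa using (this.tendsto 0).mono_left nhdsWithin_le_nhds
    exact ge_of_tendsto hlim0 hη
  refine ⟨e, he, fun i x hx => ?_⟩
  by_cases hxV : ∀ k, x k ≤ V / C.cost i
  · exact hopt i x hx hxV
  · push Not at hxV
    obtain ⟨k, hk⟩ := hxV
    -- An excessive effort pays less than zero effort, which is already covered by `hopt`.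
    exact (hC.payoff_update_neg he i hx hk).le.trans
      ((hC.payoff_update_zero_nonneg he i).trans
        (hopt i 0 (fun _ => le_rfl) fun _ => hVc i))

end Regular

end Contest

end InterconnectedContest

theorem theorem1 {B : Type*} [Fintype B] [DecidableEq B] (C : InterconnectedContest B)
    (hvalue : ∀ k, 0 < C.value k) (hcost : ∀ i, 0 < C.cost i)
    (hspill : ∀ i k l, 0 ≤ C.spill i k l)
    (hγ_pos : 0 < C.γ) (hγ_le : C.γ ≤ 1)
    (htie_nonneg : ∀ i, 0 ≤ C.tie i) (htie_sum : C.tie 0 + C.tie 1 = 1) :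
    (∃ e, C.IsNashEquilibrium e) ∧
      ∀ e e', C.IsNashEquilibrium e → C.IsNashEquilibrium e' →
        (∀ i, C.payoff e i = C.payoff e' i) ∧
        (∀ i k, C.winProb e i k = C.winProb e' i k) ∧
        (∀ i, ∑ k, e i k = ∑ k, e' i k) := by
  have hC : C.Regular := ⟨hvalue, hcost, hspill, hγ_pos, hγ_le, htie_nonneg, htie_sum⟩
  exact ⟨hC.exists_equilibrium, fun e e' he he' =>
    ⟨hC.payoff_unique he he', hC.winProb_unique he he', hC.sum_effort_unique he he'⟩⟩
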